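/- **Conventions.** A *solution* $(X,r)$ is a nonempty set $X$ of arbitrary cardinality with a non-degenerate involutive map $r:X\times X\to X\times X$, $r(x,y)=({}^xy,x^y)$, satisfying the braid relation; $\mathcal L_x(y)={}^xy$. A *symmetric group* $(G,r)$ is a group $G$ with an involutive map $r(a,u)=({}^au,a^u)$ making $(G,G,r)$ a matched pair of groups with $uv=({}^uv)(u^v)$; it is in particular a solution. Homomorphisms of symmetric groups are group homomorphisms that preserve the braidings. The socle of $G$ is $\mathrm{soc}(G)=\{a: {}^au=u\ \forall u\in G\}$. An ideal is a normal subgroup invariant under the left and right actions of $G$. For a solution, $G(X,r)=\langle X\mid xy=zt \text{ whenever } r(x,y)=(z,t)\rangle$ with the braiding $r_G$ extending $r$; $\mathcal L: G(X,r)\to \mathrm{Sym}(X)$ extends $x\mapsto\mathcal L_x$, and $\mathcal G(X,r)$ is its image, a symmetric group with the braiding induced from $r_G$. The retraction $\mathrm{Ret}(X,r)$ is the induced solution on $X/{\sim}$, where $x\sim y$ iff $\mathcal L_x=\mathcal L_y$; $\mathrm{Ret}^0(X,r)=(X,r)$ and $\mathrm{Ret}^{j+1}=\mathrm{Ret}(\mathrm{Ret}^{j})$.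 The retraction of a symmetric group is again a symmetric group with $[a][b]=[ab]$. We write $\mathrm{mpl}(X,r)=m$ if $m\ge 0$ is the least integer such that $\mathrm{Ret}^m(X,r)$ has one element. Let $(X,r)$ be a solution, $G=G(X,r)$, $\mathcal G=\mathcal G(X,r)$, and for $j\ge0$ put $G_j=G(\mathrm{Ret}^j(X,r))$, $\mathcal G_j=\mathcal G(\mathrm{Ret}^j(X,r))$, and let $x^{(j)}$ be the image of $x\in X$ in $\mathrm{Ret}^j(X,r)$. Let $\nu_j:G_j\to G_{j+1}$, $\mathcal L^j:G_j\to\mathcal G_j$, $f_j:G_{j+1}\to\mathcal G_j$, $\varphi_j:\mathcal G_j\to\mathcal G_{j+1}$ be the group homomorphisms given by $x^{(j)}\mapsto x^{(j+1)}$, $x^{(j)}\mapsto\mathcal L_{x^{(j)}}$, $x^{(j+1)}\mapsto\mathcal L_{x^{(j)}}$, $\mathcal L_{x^{(j)}}\mapsto\mathcal L_{x^{(j+1)}}$, respectively. Let $\mathcal K_j\subseteq G$ be the preimage of $\ker\mathcal L^j$ under $\nu_{j-1}\circ\cdots\circ\nu_0:G\to G_j$ for $j\ge 0$, and $\mathcal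 K_{-1}:=\{1\}$. The *derived chain* of $G$ is $K_0=\{1\}$, $K_{j+1}=$ the preimage in $G$ of $\mathrm{soc}(\mathrm{Ret}^{j}(G,r_G))$ under the canonical map $G\to \mathrm{Ret}^j(G,r_G)$, $j\ge0$. **Theorem.** Let $(X,r)$ be a solution, with the notation above. 1. For all $j\ge0$ there is an isomorphism of symmetric groups $\mathrm{Ret}^{j+1}(G,r_G)\cong\mathcal G(\mathrm{Ret}^j(X,r))$. 2. For all $j\geq 0$ the maps $\nu_j,\mathcal L^j,f_j,\varphi_j$ are epimorphisms of symmetric groups, and the diagram they form commutes: $f_j\circ\nu_j=\mathcal L^j$, $\varphi_j\circ f_j=\mathcal L^{j+1}$ and $\varphi_j\circ\mathcal L^j=\mathcal L^{j+1}\circ\nu_j$. 3. The derived chain of $G$ consists of ideals of $(G,r_G)$ and satisfies $\{1\}=K_0\subseteq K_1=\mathcal K_0\subseteq K_2=\mathcal K_1\subseteq\cdots\subseteq K_{m}=\mathcal K_{m-1}\subseteq\cdots$. Moreover $K_0\subsetneq K_1$ if $X$ is finite or $\mathrm{mpl}\,G$ is finite. For every $m\ge0$, $$\mathrm{mpl}\,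 G=m+1\iff \mathcal K_{m-1}\subsetneq\mathcal K_m=G\iff \mathrm{mpl}\,\mathcal G=m .$$ -/

import Mathlib

universe u

/-! ### Set-theoretic solutions of the Yang--Baxter equation -/

/-- `r × id` on triples. -/
def r12 {X : Type u} (r : X × X → X × X) (p : X × X × X) : X × X × X :=
  ((r (p.1, p.2.1)).1, (r (p.1, p.2.1)).2, p.2.2)

/-- `id × r` on triples. -/
def r23 {X : Type u} (r : X × X → X × X) (p : X × X × X) : X × X × X :=
  (p.1, r p.2)

/-- A solution: a non-degenerate involutive set-theoretic solution `(X, r)` of the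
Yang--Baxter equation on a nonempty set of arbitrary cardinality. -/
structure YBSolution : Type (u + 1) where
  carrier : Type u
  nonempty : Nonempty carrier
  r : carrier × carrier → carrier × carrier
  involutive : ∀ p, r (r p) = p
  left_bij : ∀ x, Function.Bijective fun y => (r (x, y)).1
  right_bij : ∀ y, Function.Bijective fun x => (r (x, y)).2
  braid : ∀ p, r12 r (r23 r (r12 r p)) = r23 r (r12 r (r23 r p))

/-! ### Symmetric groups in the sense of Takeuchi -/

/-- `(G, σ)` is a braided group: with `σ (a, u) = (ᵃu, aᵘ)`, the triple `(G, G, σ)` is a matched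
pair of groups, and `u v = (ᵘv) (uᵛ)`. -/
structure IsBraidedGroup (G : Type u) [Group G] (σ : G × G → G × G) : Prop where
  bijective : Function.Bijective σ
  ML0 : (∀ a, (σ (a, 1)).1 = 1) ∧ ∀ v, (σ (1, v)).1 = v
  MR0 : (∀ v, (σ (1, v)).2 = 1) ∧ ∀ a, (σ (a, 1)).2 = a
  ML1 : ∀ a b v, (σ (a * b, v)).1 = (σ (a, (σ (b, v)).1)).1
  MR1 : ∀ a v w, (σ (a, v * w)).2 = (σ ((σ (a, v)).2, w)).2
  ML2 : ∀ a v w, (σ (a, v * w)).1 = (σ (a, v)).1 * (σ ((σ (a, v)).2, w)).1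
  MR2 : ∀ a b v, (σ (a * b, v)).2 = (σ (a, (σ (b, v)).1)).2 * (σ (b, v)).2
  M3 : ∀ v w, v * w = (σ (v, w)).1 * (σ (v, w)).2

/-- A symmetric group (in the sense of Takeuchi): a braided group with involutive braiding. -/
structure SymGroup : Type (u + 1) where
  carrier : Type u
  [group : Group carrier]
  r : carrier × carrier → carrier × carrier
  braided : IsBraidedGroup carrier r
  involutive : ∀ p, r (r p) = p

instance (S : SymGroup.{u}) : Group S.carrier := S.group

/-- A group homomorphism between symmetric groups which preserves the braidings, i.e. a
homomorphism of symmetric groups. -/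
def IsBraidedHom {S T : SymGroup.{u}} (f : S.carrier →* T.carrier) : Prop :=
  ∀ p, T.r (Prod.map f f p) = Prod.map f f (S.r p)

/-- An epimorphism of symmetric groups. -/
def IsBraidedEpi {S T : SymGroup.{u}} (f : S.carrier →* T.carrier) : Prop :=
  IsBraidedHom f ∧ Function.Surjective f

/-- Isomorphism of symmetric groups. -/
def SymGroup.Isomorphic (S T : SymGroup.{u}) : Prop :=
  ∃ e : S.carrier ≃* T.carrier, IsBraidedHom e.toMonoidHom

namespace SymGroup

variable (S : SymGroup.{u})

/-- The left action `ᵃv` of a symmetric group on itself. -/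
def lact (a v : S.carrier) : S.carrier := (S.r (a, v)).1

/-- The right action `aᵛ` of a symmetric group on itself. -/
def ract (a v : S.carrier) : S.carrier := (S.r (a, v)).2

theorem lact_one (v : S.carrier) : S.lact 1 v = v := S.braided.ML0.2 v
theorem lact_mul (a b v : S.carrier) : S.lact (a * b) v = S.lact a (S.lact b v) :=
  S.braided.ML1 a b v
theorem ract_one (a : S.carrier) : S.ract a 1 = a := S.braided.MR0.2 a
theorem ract_mul (a v w : S.carrier) : S.ract a (v * w) = S.ract (S.ract a v) w :=
  S.braided.MR1 a v w

theorem lact_inv_lact (a v : S.carrier) : S.lact a⁻¹ (S.lact a v) = v := by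
  rw [← lact_mul, inv_mul_cancel, lact_one]
theorem lact_lact_inv (a v : S.carrier) : S.lact a (S.lact a⁻¹ v) = v := by
  rw [← lact_mul, mul_inv_cancel, lact_one]
theorem ract_ract_inv (a v : S.carrier) : S.ract (S.ract a v) v⁻¹ = a := by
  rw [← ract_mul, mul_inv_cancel, ract_one]
theorem ract_inv_ract (a v : S.carrier) : S.ract (S.ract a v⁻¹) v = a := by
  rw [← ract_mul, inv_mul_cancel, ract_one]

theorem M3 (a b : S.carrier) : S.lact a b * S.ract a b = a * b := (S.braided.M3 a b).symm

/-- A symmetric group `(G, r)` viewed as a solution. -/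
def toYB : YBSolution.{u} where
  carrier := S.carrier
  nonempty := ⟨1⟩
  r := S.r
  involutive := S.involutive
  left_bij a := ⟨fun v w h => by
      have := congrArg (S.lact a⁻¹) (show S.lact a v = S.lact a w from h)
      rwa [lact_inv_lact, lact_inv_lact] at this,
    fun v => ⟨S.lact a⁻¹ v, S.lact_lact_inv a v⟩⟩
  right_bij v := ⟨fun a b h => by
      have := congrArg (fun t => S.ract t v⁻¹) (show S.ract a v = S.ract b v from h)
      simpa only [ract_ract_inv] using this,
    fun a => ⟨S.ract a v⁻¹, S.ract_inv_ract a v⟩⟩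
  braid := by
    rintro ⟨a, b, c⟩
    change (S.lact (S.lact a b) (S.lact (S.ract a b) c),
        S.ract (S.lact a b) (S.lact (S.ract a b) c), S.ract (S.ract a b) c) =
      (S.lact a (S.lact b c), S.lact (S.ract a (S.lact b c)) (S.ract b c),
        S.ract (S.ract a (S.lact b c)) (S.ract b c))
    have h1 : S.lact (S.lact a b) (S.lact (S.ract a b) c) = S.lact a (S.lact b c) := by
      rw [← lact_mul, M3, lact_mul]
    have h3 : S.ract (S.ract a b) c = S.ract (S.ract a (S.lact b c)) (S.ract b c) := by
      rw [← ract_mul, ← ract_mul, M3]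
    have e1 : S.lact (S.lact a b) (S.lact (S.ract a b) c) *
        S.ract (S.lact a b) (S.lact (S.ract a b) c) * S.ract (S.ract a b) c = a * b * c := by
      rw [M3, mul_assoc, M3, ← mul_assoc, M3]
    have e2 : S.lact a (S.lact b c) * S.lact (S.ract a (S.lact b c)) (S.ract b c) *
        S.ract (S.ract a (S.lact b c)) (S.ract b c) = a * b * c := by
      rw [mul_assoc, M3, ← mul_assoc, M3, mul_assoc, M3, mul_assoc]
    have h2 : S.ract (S.lact a b) (S.lact (S.ract a b) c) =
        S.lact (S.ract a (S.lact b c)) (S.ract b c) := by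
      rw [← e2, h1, ← h3] at e1
      exact mul_left_cancel (mul_right_cancel e1)
    rw [h1, h2, h3]

/-- The socle of a symmetric group: the kernel of its left action on itself. -/
def soc : Subgroup S.carrier where
  carrier := {a | ∀ v, S.lact a v = v}
  one_mem' := S.lact_one
  mul_mem' {a b} ha hb v := by rw [lact_mul, hb v, ha v]
  inv_mem' {a} ha v := by
    have := S.lact_inv_lact a v
    rwa [ha v] at this

/-- An ideal of a symmetric group `G`: a normal subgroup which is `G`-invariant. -/
def IsIdeal (H : Subgroup S.carrier) : Prop :=
  H.Normal ∧ ∀ a, ∀ h ∈ H, S.lact a h ∈ H ∧ S.ract h a ∈ H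

/-- A braiding transported along a surjective group homomorphism is again a symmetric group
structure. -/
theorem push {S : SymGroup.{u}} {H : Type u} [Group H] (f : S.carrier →* H)
    (hf : Function.Surjective f)
    (σ : H × H → H × H) (h : ∀ p, σ (Prod.map f f p) = Prod.map f f (S.r p)) :
    IsBraidedGroup H σ ∧ ∀ p, σ (σ p) = p := by
  have h1 : ∀ a b, (σ (f a, f b)).1 = f (S.r (a, b)).1 := fun a b => congrArg Prod.fst (h (a, b))
  have h2 : ∀ a b, (σ (f a, f b)).2 = f (S.r (a, b)).2 := fun a b => congrArg Prod.snd (h (a, b))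
  have hinv : ∀ p, σ (σ p) = p := by
    rintro ⟨x, y⟩
    obtain ⟨a, rfl⟩ := hf x
    obtain ⟨b, rfl⟩ := hf y
    have := h (a, b)
    rw [Prod.map_apply] at this
    rw [this, h, S.involutive, Prod.map_apply]
  have hS := S.braided
  refine ⟨⟨(show Function.Involutive σ from hinv).bijective, ⟨?_, ?_⟩, ⟨?_, ?_⟩, ?_, ?_, ?_, ?_, ?_⟩,
    hinv⟩
  · intro x
    obtain ⟨a, rfl⟩ := hf x
    rw [← map_one f, h1, hS.ML0.1]
  · intro x
    obtain ⟨a, rfl⟩ := hf x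
    rw [← map_one f, h1, hS.ML0.2]
  · intro x
    obtain ⟨a, rfl⟩ := hf x
    rw [← map_one f, h2, hS.MR0.1]
  · intro x
    obtain ⟨a, rfl⟩ := hf x
    rw [← map_one f, h2, hS.MR0.2]
  · intro x y z
    obtain ⟨a, rfl⟩ := hf x
    obtain ⟨b, rfl⟩ := hf y
    obtain ⟨c, rfl⟩ := hf z
    rw [← map_mul, h1, h1, h1, hS.ML1]
  · intro x y z
    obtain ⟨a, rfl⟩ := hf x
    obtain ⟨b, rfl⟩ := hf y
    obtain ⟨c, rfl⟩ := hf z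
    rw [← map_mul, h2, h2, h2, hS.MR1]
  · intro x y z
    obtain ⟨a, rfl⟩ := hf x
    obtain ⟨b, rfl⟩ := hf y
    obtain ⟨c, rfl⟩ := hf z
    rw [← map_mul, h1, h1, h2, h1, hS.ML2, map_mul]
  · intro x y z
    obtain ⟨a, rfl⟩ := hf x
    obtain ⟨b, rfl⟩ := hf y
    obtain ⟨c, rfl⟩ := hf z
    rw [← map_mul, h2, h2, h1, h2, hS.MR2, map_mul]
  · intro x y
    obtain ⟨a, rfl⟩ := hf x
    obtain ⟨b, rfl⟩ := hf y
    rw [h1, h2, ← map_mul, ← map_mul, ← hS.M3]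

end SymGroup

namespace YBSolution

variable (X : YBSolution.{u})

/-- The left action `ˣy`. -/
def act (x y : X.carrier) : X.carrier := (X.r (x, y)).1

/-- The right action `xʸ`. -/
def ract (x y : X.carrier) : X.carrier := (X.r (x, y)).2

theorem r_eq (x y : X.carrier) : X.r (x, y) = (X.act x y, X.ract x y) := rfl

theorem act_act_ract (x y : X.carrier) : X.act (X.act x y) (X.ract x y) = x :=
  congrArg Prod.fst (X.involutive (x, y))

theorem ract_act_ract (x y : X.carrier) : X.ract (X.act x y) (X.ract x y) = y :=
  congrArg Prod.snd (X.involutive (x, y))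

theorem l1 (x y z : X.carrier) :
    X.act (X.act x y) (X.act (X.ract x y) z) = X.act x (X.act y z) :=
  congrArg (fun t : X.carrier × X.carrier × X.carrier => t.1) (X.braid (x, y, z))

theorem m1 (x y z : X.carrier) :
    X.ract (X.act x y) (X.act (X.ract x y) z) = X.act (X.ract x (X.act y z)) (X.ract y z) :=
  congrArg (fun t => t.2.1) (X.braid (x, y, z))

theorem rr1 (x y z : X.carrier) :
    X.ract (X.ract x y) z = X.ract (X.ract x (X.act y z)) (X.ract y z) :=
  congrArg (fun t => t.2.2) (X.braid (x, y, z))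

/-- `𝓛ₓ` as a permutation. -/
noncomputable def lperm (x : X.carrier) : Equiv.Perm X.carrier :=
  Equiv.ofBijective (X.act x) (X.left_bij x)

/-- `𝓡ₓ` as a permutation. -/
noncomputable def rperm (y : X.carrier) : Equiv.Perm X.carrier :=
  Equiv.ofBijective (fun x => X.ract x y) (X.right_bij y)

@[simp] theorem lperm_apply (x y : X.carrier) : X.lperm x y = X.act x y := rfl
@[simp] theorem rperm_apply (x y : X.carrier) : X.rperm y x = X.ract x y := rfl

/-! ### The Yang--Baxter group `G(X, r)` -/

/-- The defining relations `x y = z t` whenever `r (x, y) = (z, t)`. -/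
def rels : Set (FreeGroup X.carrier) :=
  {w | ∃ x y, w = FreeGroup.of x * FreeGroup.of y *
    (FreeGroup.of (X.act x y) * FreeGroup.of (X.ract x y))⁻¹}

/-- The underlying group of `G(X, r)`. -/
abbrev Str : Type u := PresentedGroup X.rels

/-- The canonical map `X → G(X, r)`. -/
def gen (x : X.carrier) : X.Str := PresentedGroup.of x

/-- The universal property of `G(X, r)`. -/
def lift {H : Type*} [Group H] (f : X.carrier → H)
    (hf : ∀ x y, f x * f y = f (X.act x y) * f (X.ract x y)) : X.Str →* H :=
  PresentedGroup.toGroup (f := f) (by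
    rintro w ⟨x, y, rfl⟩
    simp only [map_mul, map_inv, FreeGroup.lift_apply_of]
    rw [hf, mul_inv_cancel])

@[simp] theorem lift_gen {H : Type*} [Group H] (f : X.carrier → H)
    (hf : ∀ x y, f x * f y = f (X.act x y) * f (X.ract x y)) (x : X.carrier) :
    X.lift f hf (X.gen x) = f x :=
  PresentedGroup.toGroup.of _

theorem gen_rel (x y : X.carrier) :
    X.gen x * X.gen y = X.gen (X.act x y) * X.gen (X.ract x y) := by
  have : PresentedGroup.mk X.rels (FreeGroup.of x * FreeGroup.of y *
      (FreeGroup.of (X.act x y) * FreeGroup.of (X.ract x y))⁻¹) = 1 :=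
    PresentedGroup.one_of_mem ⟨x, y, rfl⟩
  rw [map_mul, map_inv, mul_inv_eq_one, map_mul, map_mul] at this
  exact this

theorem str_induction {P : X.Str → Prop} (hg : ∀ x, P (X.gen x)) (h1 : P 1)
    (hm : ∀ a b, P a → P b → P (a * b)) (hi : ∀ a, P a → P a⁻¹) (a : X.Str) : P a := by
  have ha : a ∈ Subgroup.closure (Set.range (PresentedGroup.of (rels := X.rels))) := by
    rw [PresentedGroup.closure_range_of]; trivial
  induction ha using Subgroup.closure_induction with
  | mem x hx => obtain ⟨y, rfl⟩ := hx; exact hg y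
  | one => exact h1
  | mul x y _ _ hx hy => exact hm x y hx hy
  | inv x _ hx => exact hi x hx

/-- The canonical homomorphism `𝓛 : G(X, r) → Sym X` extending `x ↦ 𝓛ₓ`. -/
noncomputable def Lhom : X.Str →* Equiv.Perm X.carrier :=
  X.lift X.lperm fun x y => by
    ext z
    exact (X.l1 x y z).symm

/-- The canonical right action of `G(X, r)` on `X`, as a homomorphism. -/
noncomputable def Rhom : X.Str →* (Equiv.Perm X.carrier)ᵐᵒᵖ :=
  X.lift (fun y => MulOpposite.op (X.rperm y)) fun y z => by
    rw [← MulOpposite.op_mul, ← MulOpposite.op_mul]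
    congr 1
    ext x
    exact X.rr1 x y z

/-- `x ^ g` for `x ∈ X` and `g ∈ G(X, r)`. -/
noncomputable def rg (x : X.carrier) (g : X.Str) : X.carrier := (X.Rhom g).unop x

@[simp] theorem Lhom_gen (x : X.carrier) : X.Lhom (X.gen x) = X.lperm x := by simp [Lhom]
@[simp] theorem rg_one (x : X.carrier) : X.rg x 1 = x := by simp [rg]
theorem rg_mul (x : X.carrier) (g h : X.Str) : X.rg x (g * h) = X.rg (X.rg x g) h := by simp [rg]
@[simp] theorem rg_gen (x y : X.carrier) : X.rg x (X.gen y) = X.ract x y := by simp [rg, Rhom]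

/-- An affine action of `G(X, r)` on integer-valued functions, used to see that `X` embeds. -/
theorem gen_injective : Function.Injective X.gen := by
  classical
  let T : X.carrier → Equiv.Perm (X.carrier → ℤ) := fun x =>
    { toFun := fun f z => f ((X.lperm x).symm z) + (if z = x then 1 else 0)
      invFun := fun f z => f (X.lperm x z) - (if X.lperm x z = x then 1 else 0)
      left_inv := fun f => by ext z; simp [-lperm_apply]
      right_inv := fun f => by ext z; simp [-lperm_apply] }
  have hT : ∀ x y, T x * T y = T (X.act x y) * T (X.ract x y) := by
    intro x y
    ext f z
    change f ((X.lperm y).symm ((X.lperm x).symm z)) + (if (X.lperm x).symm z = y then 1 else 0) +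
        (if z = x then 1 else 0) =
      f ((X.lperm (X.ract x y)).symm ((X.lperm (X.act x y)).symm z)) +
        (if (X.lperm (X.act x y)).symm z = X.ract x y then 1 else 0) +
        (if z = X.act x y then 1 else 0)
    have e1 : (X.lperm y).symm ((X.lperm x).symm z) =
        (X.lperm (X.ract x y)).symm ((X.lperm (X.act x y)).symm z) := by
      rw [Equiv.symm_apply_eq, Equiv.symm_apply_eq]
      have := X.l1 x y ((X.lperm (X.ract x y)).symm ((X.lperm (X.act x y)).symm z))
      rw [← X.lperm_apply (X.ract x y), Equiv.apply_symm_apply, ← X.lperm_apply (X.act x y),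
        Equiv.apply_symm_apply] at this
      exact this
    have e2 : ((X.lperm x).symm z = y) ↔ (z = X.act x y) := by
      rw [Equiv.symm_apply_eq, lperm_apply]
    have e3 : ((X.lperm (X.act x y)).symm z = X.ract x y) ↔ (z = x) := by
      rw [Equiv.symm_apply_eq, lperm_apply, act_act_ract]
    rw [e1]
    simp only [e2, e3]
    ring
  intro x y h
  have h2 := congrArg (fun g => X.lift T hT g (fun _ => 0) x) h
  simp only [lift_gen] at h2
  by_contra hne
  simp [T, hne] at h2

/-- `ˣg = x g (xᵍ)⁻¹`: the left action of `X` on `G(X, r)`. -/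
noncomputable def xact (x : X.carrier) (g : X.Str) : X.Str := X.gen x * g * (X.gen (X.rg x g))⁻¹

theorem xact_mul (x : X.carrier) (g h : X.Str) :
    X.xact x (g * h) = X.xact x g * X.xact (X.rg x g) h := by
  simp only [xact, rg_mul]; group

theorem xact_one (x : X.carrier) : X.xact x 1 = 1 := by simp [xact]

theorem xact_gen (x y : X.carrier) : X.xact x (X.gen y) = X.gen (X.act x y) := by
  rw [xact, gen_rel, rg_gen]; group

/-- The right action of `G(X, r)` on `X × X`. -/
noncomputable def pact (g : X.Str) (p : X.carrier × X.carrier) : X.carrier × X.carrier :=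
  (X.rg p.1 (X.xact p.2 g), X.rg p.2 g)

theorem pact_mul (g h : X.Str) (p : X.carrier × X.carrier) :
    X.pact (g * h) p = X.pact h (X.pact g p) := by
  simp only [pact, xact_mul, rg_mul]

theorem pact_one (p : X.carrier × X.carrier) : X.pact 1 p = p := by
  simp [pact, xact_one]

theorem r_pact (g : X.Str) : ∀ p, X.r (X.pact g p) = X.pact g (X.r p) := by
  induction g using X.str_induction with
  | hg z =>
    rintro ⟨x, y⟩
    simp only [pact, xact_gen, rg_gen, r_eq]
    rw [← m1, ← rr1]
  | h1 => intro p; rw [pact_one, pact_one]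
  | hm a b ha hb => intro p; rw [pact_mul, pact_mul, hb, ha]
  | hi a ha =>
    intro p
    have h := ha (X.pact a⁻¹ p)
    rw [← pact_mul, inv_mul_cancel, pact_one] at h
    rw [h, ← pact_mul, mul_inv_cancel, pact_one]

theorem xact_injective (x : X.carrier) : Function.Injective (X.xact x) := by
  intro g g' h
  have hg : g' = g * (X.gen (X.rg x g))⁻¹ * X.gen (X.rg x g') := by
    simp only [xact] at h
    rw [mul_assoc, mul_assoc] at h
    have := mul_left_cancel h
    rw [this]; group
  set a := X.rg x g with ha
  set b := X.rg x g' with hb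
  set w := X.rg a (X.gen a)⁻¹ with hw
  have hwb : X.ract w b = b := by
    conv_rhs => rw [hb, hg, rg_mul, rg_mul, ← ha, ← hw, rg_gen]
  have hwa : X.ract w a = a := by
    rw [← rg_gen, hw, ← rg_mul, inv_mul_cancel, rg_one]
  have h1 : w = X.act w b := by
    have := X.gen_rel w b
    rw [hwb] at this
    exact X.gen_injective (mul_right_cancel this)
  have h2 : w = X.act w a := by
    have := X.gen_rel w a
    rw [hwa] at this
    exact X.gen_injective (mul_right_cancel this)
  have hab : a = b := (X.left_bij w).1 (show X.act w a = X.act w b by rw [← h1, ← h2])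
  rw [hg, ← hab]; group

theorem xact_surjective (x : X.carrier) : Function.Surjective (X.xact x) := by
  intro k
  suffices H : ∀ x, (∃ g, X.xact x g = k) ∧ ∃ g, X.xact x g = k⁻¹ from (H x).1
  induction k using X.str_induction with
  | hg z =>
    intro x
    refine ⟨?_, ?_⟩
    · obtain ⟨y, hy⟩ := (X.left_bij x).2 z
      refine ⟨X.gen y, ?_⟩
      rw [xact_gen]; exact congrArg _ hy
    · have h : X.xact (X.act z x) (X.gen (X.ract z x)) = X.gen z := by
        rw [xact_gen, act_act_ract]
      have h2 := X.xact_mul x (X.gen (X.ract z x))⁻¹ (X.gen (X.ract z x))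
      rw [inv_mul_cancel, xact_one] at h2
      have h3 : X.rg x (X.gen (X.ract z x))⁻¹ = X.act z x := by
        have := X.rg_mul (X.act z x) (X.gen (X.ract z x)) (X.gen (X.ract z x))⁻¹
        rw [mul_inv_cancel, rg_one, rg_gen, ract_act_ract] at this
        exact this.symm
      rw [h3, h] at h2
      exact ⟨_, eq_inv_of_mul_eq_one_left h2.symm⟩
  | h1 => intro x; exact ⟨⟨1, X.xact_one x⟩, ⟨1, by rw [xact_one, inv_one]⟩⟩
  | hm a b ha hb =>
    intro x
    constructor
    · obtain ⟨g, hg⟩ := (ha x).1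
      obtain ⟨h, hh⟩ := (hb (X.rg x g)).1
      exact ⟨g * h, by rw [xact_mul, hg, hh]⟩
    · obtain ⟨g, hg⟩ := (hb x).2
      obtain ⟨h, hh⟩ := (ha (X.rg x g)).2
      exact ⟨g * h, by rw [xact_mul, hg, hh, mul_inv_rev]⟩
  | hi a ha => intro x; exact ⟨(ha x).2, by rw [inv_inv]; exact (ha x).1⟩

/-- The left action of `G(X, r)` on itself extending the left action of `X` on itself. -/
noncomputable def Ghom : X.Str →* Equiv.Perm X.Str :=
  X.lift (fun x => Equiv.ofBijective (X.xact x) ⟨X.xact_injective x, X.xact_surjective x⟩) (by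
    intro x y
    ext g
    change X.xact x (X.xact y g) = X.xact (X.act x y) (X.xact (X.ract x y) g)
    have h := X.r_pact g (x, y)
    have h1 : X.gen x * X.xact y g * (X.gen (X.rg x (X.xact y g)))⁻¹ =
        X.gen x * X.gen y * g *
          (X.gen (X.pact g (x, y)).1 * X.gen (X.pact g (x, y)).2)⁻¹ := by
      simp only [pact, xact]; group
    have h2 : X.gen (X.act x y) * X.xact (X.ract x y) g *
          (X.gen (X.rg (X.act x y) (X.xact (X.ract x y) g)))⁻¹ =
        X.gen (X.act x y) * X.gen (X.ract x y) * g *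
          (X.gen (X.pact g (X.r (x, y))).1 * X.gen (X.pact g (X.r (x, y))).2)⁻¹ := by
      simp only [pact, xact, r_eq]; group
    refine h1.trans (Eq.trans ?_ h2.symm)
    rw [← h, gen_rel, X.gen_rel (X.pact g (x, y)).1]
    rfl)

/-- The left action `ᵃg` of `G(X, r)` on itself. -/
noncomputable def la (a g : X.Str) : X.Str := X.Ghom a g

/-- The right action `aᵍ = (ᵃg)⁻¹ a g` of `G(X, r)` on itself. -/
noncomputable def ra (a g : X.Str) : X.Str := (X.la a g)⁻¹ * a * g

theorem la_gen (x : X.carrier) (g : X.Str) : X.la (X.gen x) g = X.xact x g := by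
  simp only [la, Ghom, lift_gen]; rfl

theorem ra_gen (x : X.carrier) (g : X.Str) : X.ra (X.gen x) g = X.gen (X.rg x g) := by
  rw [ra, la_gen, xact]; group

theorem la_gen_gen (x y : X.carrier) : X.la (X.gen x) (X.gen y) = X.gen (X.act x y) := by
  rw [la_gen, xact_gen]

theorem la_one (g : X.Str) : X.la 1 g = g := by simp [la]
theorem la_mul (a b g : X.Str) : X.la (a * b) g = X.la a (X.la b g) := by simp [la]
theorem la_inv_la (a g : X.Str) : X.la a⁻¹ (X.la a g) = g := by
  rw [← la_mul, inv_mul_cancel, la_one]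
theorem la_la_inv (a g : X.Str) : X.la a (X.la a⁻¹ g) = g := by
  rw [← la_mul, mul_inv_cancel, la_one]

theorem la_unit (a : X.Str) : X.la a 1 = 1 := by
  induction a using X.str_induction with
  | hg x => rw [la_gen, xact_one]
  | h1 => exact X.la_one 1
  | hm a b ha hb => rw [la_mul, hb, ha]
  | hi a ha => conv_lhs => rw [← ha, la_inv_la]

theorem ra_la (a b g : X.Str) : X.ra a (X.la b g) * X.ra b g = X.ra (a * b) g := by
  simp only [ra, la_mul]; group

theorem la_mul_right (a : X.Str) : ∀ g h, X.la a (g * h) = X.la a g * X.la (X.ra a g) h := by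
  induction a using X.str_induction with
  | hg x => intro g h; rw [ra_gen, la_gen, la_gen, la_gen, xact_mul]
  | h1 => intro g h; simp [ra, la_one]
  | hm a b ha hb => intro g h; rw [la_mul, hb, ha, ← ra_la, X.la_mul a b g, X.la_mul (X.ra a _)]
  | hi a ha =>
    intro g h
    have h1 := ha (X.la a⁻¹ g) (X.la (X.ra a⁻¹ g) h)
    have h2 : X.ra a (X.la a⁻¹ g) * X.ra a⁻¹ g = 1 := by
      rw [ra_la, mul_inv_cancel]; simp [ra, la_one]
    rw [← X.la_mul (X.ra a _), h2, la_one, la_la_inv] at h1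
    rw [← h1, la_inv_la]

theorem ra_mul_right (a g h : X.Str) : X.ra a (g * h) = X.ra (X.ra a g) h := by
  have := X.la_mul_right a g h
  rw [ra, this]
  nth_rewrite 2 [ra]
  rw [ra]; group

theorem la_ra (a u : X.Str) : X.la a u * X.ra a u = a * u := by rw [ra]; group

theorem ra_unit (a : X.Str) : X.ra a 1 = a := by rw [ra, la_unit]; group

theorem ra_one (u : X.Str) : X.ra 1 u = 1 := by rw [ra, la_one]; group

theorem la_la_ra (a : X.Str) : ∀ u, X.la (X.la a u) (X.ra a u) = a := by
  have second : ∀ b : X.Str, (∀ u, X.la (X.la b u) (X.ra b u) = b) →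
      ∀ u, X.ra (X.la b u) (X.ra b u) = u := by
    intro b hb u
    rw [ra, hb, mul_assoc, la_ra]; group
  induction a using X.str_induction with
  | hg x =>
    intro u
    revert x
    induction u using X.str_induction with
    | hg y => intro x; rw [la_gen_gen, ra_gen, rg_gen, la_gen_gen, act_act_ract]
    | h1 => intro x; rw [la_unit, ra_unit, la_one]
    | hm g h hg hh =>
      intro x
      rw [la_mul_right, la_mul, ra_mul_right, ra_gen, hh, ← ra_gen, hg]
    | hi g hg =>
      intro x
      have hx : X.rg (X.rg x g⁻¹) g = x := by rw [← rg_mul, inv_mul_cancel, rg_one]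
      have h1 : X.la (X.la (X.gen (X.rg x g⁻¹)) (g * g⁻¹))
          (X.ra (X.gen (X.rg x g⁻¹)) (g * g⁻¹)) = X.gen (X.rg x g⁻¹) := by
        rw [mul_inv_cancel, la_unit, ra_unit, la_one]
      rw [la_mul_right, la_mul, ra_mul_right, X.ra_gen _ g, hx] at h1
      have h2 := hg (X.rg x g⁻¹)
      rw [ra_gen, hx] at h2
      have h3 := h1.trans h2.symm
      have h4 := congrArg (X.la (X.la (X.gen (X.rg x g⁻¹)) g)⁻¹) h3
      rwa [la_inv_la, la_inv_la] at h4
  | h1 => intro u; rw [la_one, ra_one, la_unit]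
  | hm a b ha hb =>
    intro u
    rw [← ra_la, la_mul_right, la_mul, ha, second a ha, hb]
  | hi a ha =>
    intro u
    have h1 := X.ra_la a a⁻¹ u
    rw [mul_inv_cancel, ra_one] at h1
    have h2 := X.la_mul_right (X.la a (X.la a⁻¹ u)) (X.ra a (X.la a⁻¹ u)) (X.ra a⁻¹ u)
    rw [h1, la_unit, ha, second a ha] at h2
    rw [eq_comm, mul_eq_one_iff_inv_eq] at h2
    exact h2.symm

/-- The symmetric group `G(X, r) = (G, r_G)` associated to a solution. -/
noncomputable def symGroup : SymGroup.{u} where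
  carrier := X.Str
  r p := (X.la p.1 p.2, X.ra p.1 p.2)
  involutive := by
    rintro ⟨a, u⟩
    have h := X.la_la_ra a u
    refine Prod.ext h ?_
    change X.ra (X.la a u) (X.ra a u) = u
    rw [ra, h, mul_assoc, la_ra]; group
  braided :=
    { bijective := Function.Involutive.bijective (by
        rintro ⟨a, u⟩
        have h := X.la_la_ra a u
        refine Prod.ext h ?_
        change X.ra (X.la a u) (X.ra a u) = u
        rw [ra, h, mul_assoc, la_ra]; group)
      ML0 := ⟨X.la_unit, X.la_one⟩
      MR0 := ⟨X.ra_one, X.ra_unit⟩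
      ML1 := X.la_mul
      MR1 := X.ra_mul_right
      ML2 := fun a => X.la_mul_right a
      MR2 := fun a b v => (X.ra_la a b v).symm
      M3 := fun v w => (X.la_ra v w).symm }

/-- The braiding `r_G` extends `r`. -/
theorem symGroup_r_gen (x y : X.carrier) :
    X.symGroup.r (X.gen x, X.gen y) = (X.gen (X.act x y), X.gen (X.ract x y)) :=
  Prod.ext (X.la_gen_gen x y) ((X.ra_gen x _).trans (by rw [rg_gen]))

/-! ### The kernel of `𝓛` acts trivially on `G` -/

theorem la_of_ker (g : X.Str) : ∀ a, X.Lhom a = 1 → X.la a g = g := by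
  have hgen : ∀ (a : X.Str) x, X.la a (X.gen x) = X.gen (X.Lhom a x) := by
    intro a
    induction a using X.str_induction with
    | hg y => intro x; rw [la_gen_gen, Lhom_gen, lperm_apply]
    | h1 => intro x; rw [la_one, map_one]; rfl
    | hm a b ha hb => intro x; rw [la_mul, hb, ha, map_mul]; rfl
    | hi a ha =>
      intro x
      have := ha ((X.Lhom a)⁻¹ x)
      rw [show X.Lhom a ((X.Lhom a)⁻¹ x) = x from (X.Lhom a).apply_symm_apply x] at this
      rw [← this, la_inv_la, map_inv]
  have hra : ∀ a g, X.Lhom a = 1 → X.la a g = g → X.Lhom (X.ra a g) = 1 := by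
    intro a g ha h
    rw [ra, h, map_mul, map_mul, ha, map_inv]; group
  induction g using X.str_induction with
  | hg x => intro a ha; rw [hgen, ha]; rfl
  | h1 => intro a _; exact X.la_unit a
  | hm g h hg hh => intro a ha; rw [la_mul_right, hg a ha, hh _ (hra a g ha (hg a ha))]
  | hi g hg =>
    intro a ha
    have hc : X.Lhom (g * a * g⁻¹) = 1 := by rw [map_mul, map_mul, ha, map_inv]; group
    have h := X.la_mul_right (g * a * g⁻¹) g g⁻¹
    have hr : X.ra (g * a * g⁻¹) g = a := by rw [ra, hg _ hc]; group
    rw [mul_inv_cancel, la_unit, hg _ hc, hr, eq_comm, mul_eq_one_iff_inv_eq] at h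
    exact h.symm

theorem la_congr {a b : X.Str} (h : X.Lhom a = X.Lhom b) (g : X.Str) : X.la a g = X.la b g := by
  have h1 : X.Lhom (b⁻¹ * a) = 1 := by rw [map_mul, map_inv, h, inv_mul_cancel]
  have h2 := congrArg (X.la b) (X.la_of_ker g _ h1)
  rwa [← la_mul, mul_inv_cancel_left] at h2

/-- `𝓛` of the actions depends only on `𝓛` of the arguments. -/
theorem Lhom_la {a b g h : X.Str} (hab : X.Lhom a = X.Lhom b) (hgh : X.Lhom g = X.Lhom h) :
    X.Lhom (X.la a g) = X.Lhom (X.la b h) := by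
  rw [X.la_congr hab]
  -- `h = g k` with `k` in the kernel
  obtain ⟨k, rfl⟩ : ∃ k, h = g * k := ⟨g⁻¹ * h, by group⟩
  have hk : X.Lhom k = 1 := by
    rw [map_mul] at hgh
    exact (mul_eq_left.mp hgh.symm)
  have key : ∀ u k : X.Str, X.Lhom k = 1 → X.la u k = u * k * u⁻¹ := by
    intro u k hk
    have h1 : X.la (u * k * u⁻¹) u = u := X.la_of_ker u _ (by
      rw [map_mul, map_mul, hk, map_inv]; group)
    have h2 : X.ra (u * k * u⁻¹) u = k := by rw [ra, h1]; group
    have h3 := X.la_la_ra (u * k * u⁻¹) u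
    rwa [h1, h2] at h3
  rw [la_mul_right, map_mul, key _ k hk, map_mul, map_mul, hk, map_inv]
  group

theorem Lhom_ra {a b g h : X.Str} (hab : X.Lhom a = X.Lhom b) (hgh : X.Lhom g = X.Lhom h) :
    X.Lhom (X.ra a g) = X.Lhom (X.ra b h) := by
  rw [ra, ra, map_mul, map_mul, map_mul, map_mul, map_inv, map_inv, hab, hgh, X.Lhom_la hab hgh]

/-! ### The Yang--Baxter permutation group `𝓖(X, r)` -/

/-- The braiding of the permutation group `𝓖(X, r) = 𝓛(G) ≤ Sym X`: it is induced from the one of `G`, that is, `r_𝓖 (𝓛ₐ, 𝓛_b) = (𝓛_{ᵃb}, 𝓛_{aᵇ})` for `a, b ∈ G`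
(see `isBraidedEpi_toPerm`). -/
noncomputable def permBraiding (p : X.Lhom.range × X.Lhom.range) : X.Lhom.range × X.Lhom.range :=
  Prod.map X.Lhom.rangeRestrict X.Lhom.rangeRestrict
    (X.symGroup.r (Function.surjInv X.Lhom.rangeRestrict_surjective p.1,
      Function.surjInv X.Lhom.rangeRestrict_surjective p.2))

theorem permBraiding_map (p : X.Str × X.Str) :
    X.permBraiding (Prod.map X.Lhom.rangeRestrict X.Lhom.rangeRestrict p) =
      Prod.map X.Lhom.rangeRestrict X.Lhom.rangeRestrict (X.symGroup.r p) := by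
  have hs : ∀ a, X.Lhom (Function.surjInv X.Lhom.rangeRestrict_surjective
      (X.Lhom.rangeRestrict a)) = X.Lhom a := fun a =>
    congrArg Subtype.val
      (Function.surjInv_eq X.Lhom.rangeRestrict_surjective (X.Lhom.rangeRestrict a))
  exact Prod.ext (Subtype.ext (X.Lhom_la (hs p.1) (hs p.2)))
    (Subtype.ext (X.Lhom_ra (hs p.1) (hs p.2)))

/-- The symmetric group `𝓖(X, r)`, with underlying group `𝓛(G) ≤ Sym X`. -/
noncomputable def permGroup : SymGroup.{u} where
  carrier := X.Lhom.range
  r := X.permBraiding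
  braided := (SymGroup.push (S := X.symGroup) X.Lhom.rangeRestrict X.Lhom.rangeRestrict_surjective
    X.permBraiding X.permBraiding_map).1
  involutive := (SymGroup.push (S := X.symGroup) X.Lhom.rangeRestrict
    X.Lhom.rangeRestrict_surjective X.permBraiding X.permBraiding_map).2

/-- The canonical homomorphism `𝓛 : G(X, r) → 𝓖(X, r)`, `x ↦ 𝓛ₓ`. -/
noncomputable def toPerm : X.symGroup.carrier →* X.permGroup.carrier := X.Lhom.rangeRestrict

theorem isBraidedEpi_toPerm : IsBraidedEpi (S := X.symGroup) (T := X.permGroup) X.toPerm :=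
  ⟨X.permBraiding_map, X.Lhom.rangeRestrict_surjective⟩

/-! ### Retractions -/

/-- `x ∼ y` iff `𝓛ₓ = 𝓛_y`. -/
def retSetoid : Setoid X.carrier where
  r x y := X.act x = X.act y
  iseqv := ⟨fun _ => rfl, Eq.symm, Eq.trans⟩

theorem retSetoid_iff {x y : X.carrier} :
    X.retSetoid x y ↔ X.Lhom (X.gen x) = X.Lhom (X.gen y) := by
  rw [Lhom_gen, Lhom_gen]
  exact ⟨fun h => Equiv.ext fun z => congrFun h z, fun h => funext fun z => Equiv.congr_fun h z⟩

theorem ret_act {x x' y y' : X.carrier} (hx : X.retSetoid x x') (hy : X.retSetoid y y') :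
    X.retSetoid (X.act x y) (X.act x' y') := by
  rw [retSetoid_iff] at *
  rw [← la_gen_gen, ← la_gen_gen]
  exact X.Lhom_la hx hy

theorem ret_ract {x x' y y' : X.carrier} (hx : X.retSetoid x x') (hy : X.retSetoid y y') :
    X.retSetoid (X.ract x y) (X.ract x' y') := by
  rw [retSetoid_iff] at *
  rw [← rg_gen, ← rg_gen, ← ra_gen, ← ra_gen]
  exact X.Lhom_ra hx hy

/-- The induced map `r_{[X]} ([x], [y]) = ([ˣy], [xʸ])`. -/
def retR (p : Quotient X.retSetoid × Quotient X.retSetoid) :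
    Quotient X.retSetoid × Quotient X.retSetoid :=
  (Quotient.map₂ X.act (fun _ _ hx _ _ hy => X.ret_act hx hy) p.1 p.2,
    Quotient.map₂ X.ract (fun _ _ hx _ _ hy => X.ret_ract hx hy) p.1 p.2)

/-- The retraction `Ret(X, r) = ([X], r_{[X]})`. -/
def ret : YBSolution.{u} where
  carrier := Quotient X.retSetoid
  nonempty := X.nonempty.map (Quotient.mk _)
  r := X.retR
  involutive := by
    rintro ⟨x, y⟩
    induction x using Quotient.inductionOn
    induction y using Quotient.inductionOn
    rename_i x y
    exact congrArg (fun p => (Quotient.mk X.retSetoid p.1, Quotient.mk X.retSetoid p.2))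
      (X.involutive (x, y))
  left_bij x := by
    induction x using Quotient.inductionOn
    rename_i x
    refine ⟨fun y y' h => ?_, fun y => ?_⟩
    · induction y using Quotient.inductionOn
      induction y' using Quotient.inductionOn
      rename_i y y'
      have h1 : X.retSetoid (X.act x y) (X.act x y') := Quotient.exact h
      apply Quotient.sound
      change X.retSetoid y y'
      rw [retSetoid_iff, ← la_gen_gen, ← la_gen_gen] at h1
      have := X.Lhom_la (a := (X.gen x)⁻¹) rfl h1
      rwa [la_inv_la, la_inv_la, ← retSetoid_iff] at this
    · induction y using Quotient.inductionOn
      rename_i y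
      obtain ⟨z, hz⟩ := (X.left_bij x).2 y
      exact ⟨Quotient.mk _ z, congrArg (Quotient.mk _) hz⟩
  right_bij y := by
    induction y using Quotient.inductionOn
    rename_i y
    refine ⟨fun x x' h => ?_, fun x => ?_⟩
    · induction x using Quotient.inductionOn
      induction x' using Quotient.inductionOn
      rename_i x x'
      have h1 : X.retSetoid (X.ract x y) (X.ract x' y) := Quotient.exact h
      apply Quotient.sound
      change X.retSetoid x x'
      rw [retSetoid_iff] at h1
      have := X.Lhom_ra (g := (X.gen y)⁻¹) h1 rfl
      rw [ra_gen, ra_gen, ← rg_gen, ← rg_gen, ← rg_mul, ← rg_mul, mul_inv_cancel, rg_one,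
        rg_one] at this
      rwa [retSetoid_iff]
    · induction x using Quotient.inductionOn
      rename_i x
      obtain ⟨z, hz⟩ := (X.right_bij y).2 x
      exact ⟨Quotient.mk _ z, congrArg (Quotient.mk _) hz⟩
  braid := by
    rintro ⟨x, y, z⟩
    induction x using Quotient.inductionOn
    induction y using Quotient.inductionOn
    induction z using Quotient.inductionOn
    rename_i x y z
    exact congrArg (fun p => (Quotient.mk X.retSetoid p.1, Quotient.mk X.retSetoid p.2.1,
      Quotient.mk X.retSetoid p.2.2)) (X.braid (x, y, z))

/-- The canonical map `X → [X]`, `x ↦ [x]`. -/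
def toRet (x : X.carrier) : X.ret.carrier := Quotient.mk _ x

theorem toRet_act (x y : X.carrier) : X.toRet (X.act x y) = X.ret.act (X.toRet x) (X.toRet y) := rfl
theorem toRet_ract (x y : X.carrier) :
    X.toRet (X.ract x y) = X.ret.ract (X.toRet x) (X.toRet y) := rfl

/-- The higher retractions `Ret^j(X, r)`. -/
def retIter : ℕ → YBSolution.{u}
  | 0 => X
  | j + 1 => (retIter j).ret

/-- `mpl (X, r) = m`: `m` is the least number such that `Ret^m(X, r)` is a one element solution
(carriers of solutions are nonempty). -/
def MplEq (m : ℕ) : Prop :=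
  IsLeast {k : ℕ | Subsingleton (X.retIter k).carrier} m

/-! ### The canonical homomorphisms `ν`, `f`, `φ` -/

/-- The homomorphism of groups underlying `ν`. -/
def nuStr : X.Str →* X.ret.Str :=
  X.lift (fun x => X.ret.gen (X.toRet x)) fun _ _ => X.ret.gen_rel _ _

/-- `ν : G(X) → G(Ret X)`, `x ↦ [x]`. -/
noncomputable def nu : X.symGroup.carrier →* X.ret.symGroup.carrier := X.nuStr

/-- The permutation group generator `𝓛ₓ ∈ 𝓖(X)`. -/
noncomputable def permGen (x : X.carrier) : X.permGroup.carrier := X.toPerm (X.gen x)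

/-- `f : G(Ret X) → 𝓖(X)`, `[x] ↦ 𝓛ₓ`. -/
noncomputable def retToPerm : X.ret.symGroup.carrier →* X.permGroup.carrier :=
  X.ret.lift (Quotient.lift X.permGen fun _ _ h => Subtype.ext (X.retSetoid_iff.mp h)) (by
    intro x y
    induction x using Quotient.inductionOn
    induction y using Quotient.inductionOn
    rename_i x y
    change X.toPerm (X.gen x) * X.toPerm (X.gen y) =
      X.toPerm (X.gen (X.act x y)) * X.toPerm (X.gen (X.ract x y))
    exact (X.toPerm.map_mul _ _).symm.trans
      ((congrArg X.toPerm (X.gen_rel x y)).trans (X.toPerm.map_mul _ _)))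

theorem Lhom_nu (a : X.Str) (x : X.carrier) :
    X.ret.Lhom (X.nuStr a) (X.toRet x) = X.toRet (X.Lhom a x) := by
  revert x
  induction a using X.str_induction with
  | hg y =>
    intro x
    have : X.nuStr (X.gen y) = X.ret.gen (X.toRet y) := X.lift_gen _ _ _
    rw [this, Lhom_gen, Lhom_gen, lperm_apply, lperm_apply, toRet_act]
  | h1 => intro x; rw [map_one, map_one]; exact congrArg _ (by rw [map_one]; rfl)
  | hm a b ha hb =>
    intro x
    rw [map_mul, map_mul, map_mul, Equiv.Perm.mul_apply, Equiv.Perm.mul_apply, hb, ha]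
  | hi a ha =>
    intro x
    rw [map_inv, map_inv, map_inv, Equiv.Perm.inv_eq_iff_eq, ha]
    exact congrArg X.toRet ((X.Lhom a).apply_symm_apply x).symm

/-- `φ : 𝓖(X) → 𝓖(Ret X)`, `𝓛ₓ ↦ 𝓛_{[x]}`. -/
noncomputable def phi : X.permGroup.carrier →* X.ret.permGroup.carrier :=
  X.toPerm.liftOfSurjective X.isBraidedEpi_toPerm.2
    ⟨X.ret.toPerm.comp X.nu, by
      intro a ha
      have h1 : X.Lhom a = 1 := congrArg Subtype.val (MonoidHom.mem_ker.mp ha)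
      rw [MonoidHom.mem_ker]
      apply Subtype.ext
      change X.ret.Lhom (X.nu a) = 1
      ext x
      induction x using Quotient.inductionOn
      rename_i x
      exact (X.Lhom_nu a x).trans (by rw [h1]; rfl)⟩

end YBSolution

namespace SymGroup

variable (S : SymGroup.{u})

/-- The congruence `a ∼ b` iff `𝓛ₐ = 𝓛_b` on a symmetric group; so `[a] [b] = [a b]`. -/
def retCon : Con S.carrier where
  toSetoid := S.toYB.retSetoid
  mul' {a b c d} hab hcd := by
    funext v
    change S.lact (a * c) v = S.lact (b * d) v
    exact (S.lact_mul a c v).trans (((congrArg (S.lact a) (congrFun hcd v)).trans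
      (congrFun hab (S.lact d v))).trans (S.lact_mul b d v).symm)

theorem push_ret :
    IsBraidedGroup S.retCon.Quotient S.toYB.retR ∧ ∀ p, S.toYB.retR (S.toYB.retR p) = p :=
  push (S := S) S.retCon.mk' Con.mk'_surjective S.toYB.retR fun _ => rfl

/-- The retraction `Ret(G, r)` of a symmetric group, again as a symmetric group. -/
def ret : SymGroup.{u} where
  carrier := S.retCon.Quotient
  r := S.toYB.retR
  braided := S.push_ret.1
  involutive := S.push_ret.2

theorem toYB_ret : S.ret.toYB = S.toYB.ret := rfl

/-- The canonical epimorphism `G → Ret G`, `a ↦ [a]`. -/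
def toRet : S.carrier →* S.ret.carrier := S.retCon.mk'

/-- The higher retractions `Ret^j(G, r)` of a symmetric group. -/
def retIter : ℕ → SymGroup.{u}
  | 0 => S
  | j + 1 => (retIter j).ret

/-- The higher retractions as a symmetric group and as a solution agree. -/
theorem toYB_retIter (j : ℕ) : (S.retIter j).toYB = S.toYB.retIter j := by
  induction j with
  | zero => rfl
  | succ j ih => exact congrArg YBSolution.ret ih

/-- The canonical epimorphism `G → Ret^j G`. -/
def toRetIter : (j : ℕ) → S.carrier →* (S.retIter j).carrier
  | 0 => MonoidHom.id _
  | j + 1 => (S.retIter j).toRet.comp (toRetIter j)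

/-- The derived chain of ideals of `G`: `K_0 = {1}`, and `K_{j+1}` is the pull-back in `G` of the
socle of `Ret^j G`. -/
def derivedChain : ℕ → Subgroup S.carrier
  | 0 => ⊥
  | j + 1 => (S.retIter j).soc.comap (S.toRetIter j)

end SymGroup

namespace YBSolution

variable (X : YBSolution.{u})

/-- The image `x^{(j)}` of `x` in `Ret^j(X, r)`. -/
def img (x : X.carrier) : (j : ℕ) → (X.retIter j).carrier
  | 0 => x
  | j + 1 => (X.retIter j).toRet (img x j)

/-- The derived symmetric group `G_j = G(Ret^j(X, r))`. -/
noncomputable def derG (j : ℕ) : SymGroup.{u} := (X.retIter j).symGroup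

/-- The derived permutation group `𝓖_j = 𝓖(Ret^j(X, r))`. -/
noncomputable def derP (j : ℕ) : SymGroup.{u} := (X.retIter j).permGroup

/-- The generator `x^{(j)}` of `G_j`. -/
noncomputable def genG (x : X.carrier) (j : ℕ) : (X.derG j).carrier :=
  (X.retIter j).gen (X.img x j)

/-- The generator `𝓛_{x^{(j)}}` of `𝓖_j`. -/
noncomputable def genP (x : X.carrier) (j : ℕ) : (X.derP j).carrier :=
  (X.retIter j).permGen (X.img x j)

/-- `𝓛^j : G_j → 𝓖_j`. -/
noncomputable def LJ (j : ℕ) : (X.derG j).carrier →* (X.derP j).carrier := (X.retIter j).toPerm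

/-- `ν_j : G_j → G_{j+1}`. -/
noncomputable def nuJ (j : ℕ) : (X.derG j).carrier →* (X.derG (j + 1)).carrier := (X.retIter j).nu

/-- `f_j : G_{j+1} → 𝓖_j`. -/
noncomputable def fJ (j : ℕ) : (X.derG (j + 1)).carrier →* (X.derP j).carrier :=
  (X.retIter j).retToPerm

/-- `φ_j : 𝓖_j → 𝓖_{j+1}`. -/
noncomputable def phiJ (j : ℕ) : (X.derP j).carrier →* (X.derP (j + 1)).carrier :=
  (X.retIter j).phi

/-- The composite `ν_{j-1} ∘ ⋯ ∘ ν_0 : G → G_j`. -/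
noncomputable def toDerG : (j : ℕ) → X.symGroup.carrier →* (X.derG j).carrier
  | 0 => MonoidHom.id _
  | j + 1 => (X.nuJ j).comp (toDerG j)

/-- `𝓚_j`, the pull-back of `ker 𝓛^j` in `G`. -/
noncomputable def kerPullback (j : ℕ) : Subgroup X.symGroup.carrier :=
  (X.LJ j).ker.comap (X.toDerG j)

end YBSolution

/-! Every symmetric group in sight is an epimorphic image of `G = G(X, r)`, and such an image is
determined up to isomorphism by the kernel of the epimorphism. The theorem therefore reduces to
comparing kernels in `G`.

The retraction of a symmetric group is its quotient by the socle (`ker_toRet`), so the tower `G →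
Ret G → Ret² G → ⋯` divides out a socle at each stage and `K_j` is the kernel of `G → Ret^j G`. The
tower `G → 𝓖_0 → 𝓖_1 → ⋯` with maps `𝓛^0, φ_0, φ_1, …` does the same: `ker 𝓛` is the socle of `G`
(`ker_toPerm`) because `X` embeds in `G`, and `ker φ` is the socle of `𝓖(X)` (`ker_phi`) because
`Ret X` embeds in `𝓖(X)` as its set of generators. The pull-back of a socle along an epimorphism
depends only on the kernel (`comap_soc_congr`), so induction gives `K_{j+1} = 𝓚_j`
(`derivedChain_succ`) and with it the isomorphisms.

Multipermutation levels are then read off the increasing chain: `Ret^k G` is trivial exactly when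
`K_k = G`. The chain of `𝓖` pulls back to the chain of `G` shifted by one. Finally, `G` maps onto
`ℤ`, so `K_0 ≠ G`; this makes the shift compatible with least indices and, when `X` or the level of
`G` is finite, forces a nontrivial socle. -/

/-! ### Homomorphisms of symmetric groups -/

namespace IsBraidedHom

variable {S T U : SymGroup.{u}}

theorem map_lact {f : S.carrier →* T.carrier} (hf : IsBraidedHom f) (a v : S.carrier) :
    f (S.lact a v) = T.lact (f a) (f v) :=
  (congrArg Prod.fst (hf (a, v))).symm

theorem map_ract {f : S.carrier →* T.carrier} (hf : IsBraidedHom f) (a v : S.carrier) :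
    f (S.ract a v) = T.ract (f a) (f v) :=
  (congrArg Prod.snd (hf (a, v))).symm

/-- Since `a v = (ᵃv)(aᵛ)`, the right action is determined by the product and the left action, so
only the latter has to be checked. -/
theorem of_map_lact {f : S.carrier →* T.carrier}
    (hf : ∀ a v, f (S.lact a v) = T.lact (f a) (f v)) : IsBraidedHom f := by
  rintro ⟨a, v⟩
  refine Prod.ext (hf a v).symm ?_
  change T.ract (f a) (f v) = f (S.ract a v)
  have h := T.M3 (f a) (f v)
  rw [← hf, ← map_mul, ← S.M3 a v, map_mul] at h
  exact mul_left_cancel h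

theorem comp {g : T.carrier →* U.carrier} {f : S.carrier →* T.carrier} (hg : IsBraidedHom g)
    (hf : IsBraidedHom f) : IsBraidedHom (S := S) (T := U) (g.comp f) :=
  of_map_lact fun a v => by
    rw [MonoidHom.comp_apply, hf.map_lact, hg.map_lact]; rfl

/-- The kernel of a homomorphism of symmetric groups is an ideal. -/
theorem isIdeal_ker {f : S.carrier →* T.carrier} (hf : IsBraidedHom f) : S.IsIdeal f.ker := by
  refine ⟨inferInstance, fun a h hh => ⟨?_, ?_⟩⟩
  · rw [MonoidHom.mem_ker] at hh ⊢
    rw [hf.map_lact, hh]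
    exact T.braided.ML0.1 _
  · rw [MonoidHom.mem_ker] at hh ⊢
    rw [hf.map_ract, hh]
    exact T.braided.MR0.1 _

end IsBraidedHom

/-! ### Epimorphisms and their kernels -/

namespace IsBraidedEpi

variable {S T T' U : SymGroup.{u}}

theorem comp {g : T.carrier →* U.carrier} {f : S.carrier →* T.carrier} (hg : IsBraidedEpi g)
    (hf : IsBraidedEpi f) : IsBraidedEpi (S := S) (T := U) (g.comp f) :=
  ⟨hg.1.comp hf.1, hg.2.comp hf.2⟩

/-- A homomorphism whose composite with an epimorphism of symmetric groups is an epimorphism of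
symmetric groups is itself one. -/
theorem of_comp {g : T.carrier →* U.carrier} {f : S.carrier →* T.carrier} (hf : IsBraidedEpi f)
    (h : IsBraidedEpi (S := S) (T := U) (g.comp f)) : IsBraidedEpi g := by
  refine ⟨IsBraidedHom.of_map_lact fun a v => ?_, Function.Surjective.of_comp h.2⟩
  obtain ⟨a, rfl⟩ := hf.2 a
  obtain ⟨v, rfl⟩ := hf.2 v
  rw [← hf.1.map_lact]
  exact h.1.map_lact a v

/-- By surjectivity the socle condition can be tested in the source, where it mentions `T` only
through equalities between values of `f`. -/
theorem mem_comap_soc {f : S.carrier →* T.carrier} (hf : IsBraidedEpi f) (a : S.carrier) :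
    a ∈ T.soc.comap f ↔ ∀ v, f (S.lact a v) = f v := by
  change (∀ w, T.lact (f a) w = w) ↔ _
  rw [hf.2.forall]
  simp only [hf.1.map_lact]

/-- Equalities between values of a homomorphism are decided by its kernel. This is the induction
step whenever two towers of socle quotients are compared. -/
theorem comap_soc_congr {f : S.carrier →* T.carrier} {f' : S.carrier →* T'.carrier}
    (hf : IsBraidedEpi f) (hf' : IsBraidedEpi f') (h : f.ker = f'.ker) :
    T.soc.comap f = T'.soc.comap f' := by
  ext a
  rw [hf.mem_comap_soc, hf'.mem_comap_soc]
  simp only [← MonoidHom.div_mem_ker_iff, h]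

theorem subsingleton_iff {f : S.carrier →* T.carrier} (hf : IsBraidedEpi f) :
    Subsingleton T.carrier ↔ f.ker = ⊤ := by
  refine ⟨fun _ => ?_, fun h => ?_⟩
  · ext a
    simp [MonoidHom.mem_ker, Subsingleton.elim (f a) 1]
  · refine subsingleton_of_forall_eq 1 fun b => ?_
    obtain ⟨a, rfl⟩ := hf.2 b
    rw [← MonoidHom.mem_ker, h]
    trivial

/-- Two epimorphic images of a symmetric group with the same kernel are isomorphic. -/
theorem isomorphic {f : S.carrier →* T.carrier} {f' : S.carrier →* T'.carrier}
    (hf : IsBraidedEpi f) (hf' : IsBraidedEpi f') (h : f.ker = f'.ker) : T.Isomorphic T' := by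
  -- The first isomorphism theorem gives `e` with `e ∘ f = f'`; cancelling the epimorphism `f` then
  -- shows that `e` respects the braidings.
  let e : T.carrier ≃* T'.carrier :=
    (QuotientGroup.quotientKerEquivOfSurjective f hf.2).symm.trans
      ((QuotientGroup.quotientMulEquivOfEq h).trans
        (QuotientGroup.quotientKerEquivOfSurjective f' hf'.2))
  have he : ∀ a, e (f a) = f' a := by
    intro a
    have h1 : (QuotientGroup.quotientKerEquivOfSurjective f hf.2).symm (f a) = a := by
      rw [MulEquiv.symm_apply_eq]; rfl
    simp only [e, MulEquiv.trans_apply, h1]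
    rfl
  refine ⟨e, (of_comp (g := e.toMonoidHom) hf ?_).1⟩
  have : e.toMonoidHom.comp f = f' := MonoidHom.ext he
  rwa [this]

end IsBraidedEpi

/-! ### The socle -/

namespace SymGroup

variable (S : SymGroup.{u})

theorem lact_mul_right (a v w : S.carrier) :
    S.lact a (v * w) = S.lact a v * S.lact (S.ract a v) w := S.braided.ML2 a v w

theorem lact_unit (a : S.carrier) : S.lact a 1 = 1 := S.braided.ML0.1 a

theorem ract_eq (a v : S.carrier) : S.ract a v = (S.lact a v)⁻¹ * (a * v) := by
  rw [← S.M3 a v, inv_mul_cancel_left]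

/-- A normal subgroup which acts trivially on a set of generators lies in the socle. -/
theorem le_soc_of_closure {K : Subgroup S.carrier} [K.Normal] {s : Set S.carrier}
    (hs : Subgroup.closure s = ⊤) (h : ∀ a ∈ K, ∀ x ∈ s, S.lact a x = x) : K ≤ S.soc := by
  intro a ha v
  have hv : v ∈ Subgroup.closure s := hs ▸ Subgroup.mem_top v
  -- If `a` fixes `v`, then `aᵛ = v⁻¹ a v`, which normality keeps in `K`. As `ᵃ(v w) =
  -- (ᵃv)(^{aᵛ}w)`, the induction must let `a` vary.
  have hconj : ∀ a ∈ K, ∀ v, v⁻¹ * (a * v) ∈ K := fun a ha v => by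
    simpa [mul_assoc] using Subgroup.Normal.conj_mem ‹K.Normal› a ha v⁻¹
  induction hv using Subgroup.closure_induction generalizing a with
  | mem x hx => exact h a ha x hx
  | one => exact S.lact_unit a
  | mul v w _ _ hv hw =>
    rw [lact_mul_right, ract_eq, hv ha, hw (hconj a ha v)]
  | inv v _ hv =>
    -- The conjugate is chosen so that its right translate by `v` is `a`; expanding its action on `v
    -- v⁻¹ = 1` then isolates `ᵃ(v⁻¹)`.
    have hc : v * a * v⁻¹ ∈ K := Subgroup.Normal.conj_mem ‹K.Normal› a ha v
    have h1 := S.lact_mul_right (v * a * v⁻¹) v v⁻¹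
    have h2 : v⁻¹ * (v * a * v⁻¹ * v) = a := by group
    rw [mul_inv_cancel, lact_unit, ract_eq, hv hc, h2] at h1
    exact (inv_eq_of_mul_eq_one_right h1.symm).symm

/-! ### Retractions and the derived chain -/

theorem isBraidedEpi_toRet : IsBraidedEpi S.toRet := ⟨fun _ => rfl, Con.mk'_surjective⟩

theorem ker_toRet : S.toRet.ker = S.soc := by
  ext a
  rw [MonoidHom.mem_ker, ← map_one S.toRet]
  refine (Con.eq S.retCon).trans ?_
  change S.lact a = S.lact 1 ↔ ∀ v, S.lact a v = v
  rw [funext_iff]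
  simp only [lact_one]

theorem isBraidedEpi_toRetIter (j : ℕ) : IsBraidedEpi (S.toRetIter j) := by
  induction j with
  | zero => exact ⟨fun _ => rfl, Function.surjective_id⟩
  | succ j ih => exact (S.retIter j).isBraidedEpi_toRet.comp ih

theorem ker_toRet_comp {S T : SymGroup.{u}} (f : S.carrier →* T.carrier) :
    (T.toRet.comp f).ker = T.soc.comap f := by
  rw [← T.ker_toRet, MonoidHom.comap_ker]

/-- The socle of `Ret^j` is exactly what the next retraction kills. -/
theorem derivedChain_eq_ker (j : ℕ) : S.derivedChain j = (S.toRetIter j).ker := by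
  cases j with
  | zero => exact MonoidHom.ker_id.symm
  | succ j => exact (ker_toRet_comp _).symm

theorem isIdeal_derivedChain (j : ℕ) : S.IsIdeal (S.derivedChain j) := by
  rw [derivedChain_eq_ker]
  exact (S.isBraidedEpi_toRetIter j).1.isIdeal_ker

theorem monotone_derivedChain : Monotone S.derivedChain := by
  refine monotone_nat_of_le_succ fun j a ha => ?_
  rw [derivedChain_eq_ker, MonoidHom.mem_ker] at *
  exact (congrArg (S.retIter j).toRet ha).trans (map_one _)

theorem subsingleton_retIter_iff (k : ℕ) :
    Subsingleton (S.toYB.retIter k).carrier ↔ S.derivedChain k = ⊤ := by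
  rw [derivedChain_eq_ker, ← (S.isBraidedEpi_toRetIter k).subsingleton_iff, ← toYB_retIter]
  rfl

theorem mplEq_iff (m : ℕ) : S.toYB.MplEq m ↔ IsLeast {k | S.derivedChain k = ⊤} m := by
  simp only [YBSolution.MplEq, subsingleton_retIter_iff]

/-- The chain is increasing, so once it reaches the whole group it stays there; minimality only has
to be tested one step earlier. -/
theorem mplEq_succ_iff (m : ℕ) :
    S.toYB.MplEq (m + 1) ↔
      S.derivedChain m < S.derivedChain (m + 1) ∧ S.derivedChain (m + 1) = ⊤ := by
  rw [mplEq_iff]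
  constructor
  · rintro ⟨h, hmin⟩
    have h' : S.derivedChain (m + 1) = ⊤ := h
    refine ⟨?_, h⟩
    rw [h', lt_top_iff_ne_top]
    exact fun hm => absurd (hmin hm) (by simp)
  · rintro ⟨hlt, h⟩
    refine ⟨h, fun k hk => ?_⟩
    by_contra hkm
    have hle := S.monotone_derivedChain (show k ≤ m by omega)
    rw [show S.derivedChain k = ⊤ from hk] at hle
    exact (hlt.trans_le le_top).not_ge hle

/-- With a trivial socle no retraction identifies anything: a trivial `K_j` is also the kernel of
the identity, so `K_{j+1}` is again the socle of `S`. -/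
theorem derivedChain_eq_bot (h : S.derivedChain 1 = ⊥) (j : ℕ) : S.derivedChain j = ⊥ := by
  induction j with
  | zero => rfl
  | succ j ih =>
    rw [← h]
    rw [derivedChain_eq_ker] at ih
    exact (S.isBraidedEpi_toRetIter j).comap_soc_congr (S.isBraidedEpi_toRetIter 0)
      (ih.trans MonoidHom.ker_id.symm)

/-- An epimorphism whose kernel is the socle shifts the derived chain. -/
theorem comap_derivedChain {S T : SymGroup.{u}} {f : S.carrier →* T.carrier} (hf : IsBraidedEpi f)
    (h : f.ker = S.soc) (k : ℕ) : (T.derivedChain k).comap f = S.derivedChain (k + 1) := by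
  induction k with
  | zero => exact h
  | succ k ih =>
    rw [derivedChain_eq_ker, derivedChain_eq_ker, MonoidHom.comap_ker] at ih
    exact ((T.isBraidedEpi_toRetIter k).comp hf).comap_soc_congr
      (S.isBraidedEpi_toRetIter (k + 1)) ih

/-- Pulling back along a surjection loses no information about subgroups. -/
theorem derivedChain_eq_top_iff {S T : SymGroup.{u}} {f : S.carrier →* T.carrier}
    (hf : IsBraidedEpi f) (h : f.ker = S.soc) (k : ℕ) :
    T.derivedChain k = ⊤ ↔ S.derivedChain (k + 1) = ⊤ := by
  rw [← comap_derivedChain hf h, ← Subgroup.comap_top f,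
    (Subgroup.comap_injective hf.2).eq_iff]

end SymGroup

/-! ### The group `G(X, r)`: generators, size, socle -/

namespace YBSolution

variable (X : YBSolution.{u})

theorem closure_range_gen : Subgroup.closure (Set.range X.gen) = ⊤ :=
  PresentedGroup.closure_range_of X.rels

theorem hom_ext {H : Type*} [Group H] {f g : X.symGroup.carrier →* H}
    (h : ∀ x, f (X.gen x) = g (X.gen x)) : f = g :=
  PresentedGroup.ext h

/-- Links the action of `G` on itself to its action on `X`, which is what lets socles be compared
with kernels of permutation representations. -/
theorem la_gen_eq (a : X.Str) : ∀ x, X.la a (X.gen x) = X.gen (X.Lhom a x) := by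
  induction a using X.str_induction with
  | hg y => intro x; rw [la_gen_gen, Lhom_gen, lperm_apply]
  | h1 => intro x; rw [la_one, map_one]; rfl
  | hm a b ha hb => intro x; rw [la_mul, hb, ha, map_mul]; rfl
  | hi a ha =>
    intro x
    have := ha ((X.Lhom a)⁻¹ x)
    rw [show X.Lhom a ((X.Lhom a)⁻¹ x) = x from (X.Lhom a).apply_symm_apply x] at this
    rw [← this, la_inv_la, map_inv]

/-- A group homomorphism from `G(X, r)` to a symmetric group which preserves the left action on
generators is a homomorphism of symmetric groups. -/
theorem isBraidedHom_of_gen {T : SymGroup.{u}} (f : X.symGroup.carrier →* T.carrier)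
    (h : ∀ x y, f (X.gen (X.act x y)) = T.lact (f (X.gen x)) (f (X.gen y))) :
    IsBraidedHom f := by
  have fmul : ∀ a b : X.Str, f (a * b : X.Str) = f a * f b := f.map_mul
  have fone : f (1 : X.Str) = 1 := f.map_one
  have finv : ∀ a : X.Str, f (a⁻¹ : X.Str) = (f a)⁻¹ := f.map_inv
  -- Compatibility with the left action at a single pair already gives it for the right action
  -- there, as the inductions below require.
  have key : ∀ a g : X.Str, f (X.la a g) = T.lact (f a) (f g) →
      f (X.ra a g) = T.ract (f a) (f g) := by
    intro a g hag
    have h1 := T.M3 (f a) (f g)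
    rw [← hag, ← fmul, ← X.la_ra a g, fmul] at h1
    exact (mul_left_cancel h1).symm
  have hx : ∀ (g : X.Str) (x : X.carrier),
      f (X.la (X.gen x) g) = T.lact (f (X.gen x)) (f g) := by
    intro g
    induction g using X.str_induction with
    | hg y => intro x; rw [la_gen_gen, h]
    | h1 =>
      intro x
      rw [la_unit, fone, T.lact_unit]
    | hm g k hg hk =>
      intro x
      have h1 := key _ _ (hg x)
      rw [ra_gen] at h1
      rw [la_mul_right, ra_gen, fmul g k,
        T.lact_mul_right, ← h1, ← hk, ← hg, fmul]
    | hi g hg =>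
      intro x
      -- With `y ^ g = x`, the expansion of the action of `y` on `g g⁻¹ = 1` has the action of `x`
      -- on `g⁻¹` as its second factor; the same expansion in `T` is compared with it.
      set y := X.rg x g⁻¹ with hy
      have hyx : X.rg y g = x := by rw [hy, ← rg_mul, inv_mul_cancel, rg_one]
      have h1 := key _ _ (hg y)
      rw [ra_gen, hyx] at h1
      have e1 := X.la_mul_right (X.gen y) g g⁻¹
      rw [mul_inv_cancel, la_unit, ra_gen, hyx] at e1
      have e2 := T.lact_mul_right (f (X.gen y)) (f g) (f g)⁻¹
      rw [mul_inv_cancel, T.lact_unit, ← h1, ← hg] at e2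
      have e3 := congrArg f e1
      rw [fone] at e3
      rw [finv]
      exact mul_left_cancel ((f.map_mul _ _).symm.trans (e3.symm.trans e2))
  have ha : ∀ a g : X.Str, f (X.la a g) = T.lact (f a) (f g) := by
    intro a
    induction a using X.str_induction with
    | hg x => intro g; exact hx g x
    | h1 =>
      intro g
      rw [la_one, fone, T.lact_one]
    | hm a b ha hb =>
      intro g
      rw [la_mul, ha, hb, fmul, T.lact_mul]
    | hi a ha =>
      intro g
      have h1 := ha (X.la a⁻¹ g)
      rw [la_la_inv] at h1
      rw [h1, finv, T.lact_inv_lact]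
  exact IsBraidedHom.of_map_lact ha

/-- `G(X, r)` maps onto `ℤ` by sending every generator to `1`. -/
theorem infinite_symGroup : Infinite X.symGroup.carrier := by
  let d : X.Str →* Multiplicative ℤ := X.lift (fun _ => Multiplicative.ofAdd 1) fun _ _ => rfl
  obtain ⟨x⟩ := X.nonempty
  have hd : Function.Surjective d := fun n =>
    ⟨X.gen x ^ n.toAdd, by
      rw [map_zpow, show d (X.gen x) = Multiplicative.ofAdd 1 from X.lift_gen _ _ _,
        ← ofAdd_zsmul]
      simp⟩
  exact Infinite.of_surjective d hd

/-- Triviality on `X` propagates to `G` by `la_of_ker`; conversely, an element fixing all of `G`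
fixes the generators, and `X` embeds in `G`. -/
theorem ker_toPerm : X.toPerm.ker = X.symGroup.soc := by
  ext a
  have h1 : a ∈ X.toPerm.ker ↔ X.Lhom a = 1 :=
    (MonoidHom.mem_ker).trans Subtype.ext_iff
  rw [h1]
  refine ⟨fun h v => X.la_of_ker v a h, fun h => Equiv.ext fun x => ?_⟩
  exact X.gen_injective ((X.la_gen_eq a x).symm.trans (h (X.gen x)))

/-! ### The diagram of `ν`, `𝓛`, `f`, `φ` -/

theorem nu_gen (x : X.carrier) : X.nu (X.gen x) = X.ret.gen (X.toRet x) :=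
  X.lift_gen (fun x => X.ret.gen (X.toRet x)) (fun _ _ => X.ret.gen_rel _ _) x

theorem retToPerm_gen (x : X.carrier) : X.retToPerm (X.ret.gen (X.toRet x)) = X.permGen x :=
  X.ret.lift_gen _ _ _

theorem phi_toPerm (a : X.symGroup.carrier) : X.phi (X.toPerm a) = X.ret.toPerm (X.nu a) :=
  MonoidHom.liftOfRightInverse_comp_apply _ _ _ _ _

theorem phi_permGen (x : X.carrier) : X.phi (X.permGen x) = X.ret.permGen (X.toRet x) :=
  (X.phi_toPerm (X.gen x)).trans (congrArg X.ret.toPerm (X.nu_gen x))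

theorem retToPerm_comp_nu : X.retToPerm.comp X.nu = X.toPerm :=
  X.hom_ext fun x => (congrArg X.retToPerm (X.nu_gen x)).trans (X.retToPerm_gen x)

theorem phi_comp_toPerm : X.phi.comp X.toPerm = X.ret.toPerm.comp X.nu :=
  MonoidHom.ext X.phi_toPerm

theorem phi_comp_retToPerm : X.phi.comp X.retToPerm = X.ret.toPerm :=
  X.ret.hom_ext fun x => by
    induction x using Quotient.inductionOn
    rename_i x
    exact (congrArg X.phi (X.retToPerm_gen x)).trans (X.phi_permGen x)

theorem isBraidedEpi_nu : IsBraidedEpi X.nu := by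
  refine ⟨X.isBraidedHom_of_gen _ fun x y => ?_, ?_⟩
  · rw [nu_gen, nu_gen, nu_gen]
    exact (X.ret.la_gen_gen (X.toRet x) (X.toRet y)).symm
  · rw [← MonoidHom.range_eq_top, eq_top_iff]
    refine X.ret.closure_range_gen.ge.trans ((Subgroup.closure_le _).mpr ?_)
    rintro _ ⟨x, rfl⟩
    induction x using Quotient.inductionOn
    rename_i x
    exact ⟨X.gen x, X.nu_gen x⟩

/-- Cancel the epimorphism `ν` in `f ∘ ν = 𝓛`. -/
theorem isBraidedEpi_retToPerm : IsBraidedEpi X.retToPerm :=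
  X.isBraidedEpi_nu.of_comp (X.retToPerm_comp_nu ▸ X.isBraidedEpi_toPerm)

/-- Cancel the epimorphism `𝓛` in the commuting square. -/
theorem isBraidedEpi_phi : IsBraidedEpi X.phi :=
  X.isBraidedEpi_toPerm.of_comp
    (X.phi_comp_toPerm ▸ X.ret.isBraidedEpi_toPerm.comp X.isBraidedEpi_nu)

/-! ### The socle of `𝓖(X, r)` -/

theorem closure_range_permGen : Subgroup.closure (Set.range X.permGen) = ⊤ := by
  have hr : Set.range X.permGen = X.toPerm '' Set.range X.gen := Set.range_comp X.toPerm X.gen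
  rw [hr]
  exact (MonoidHom.map_closure X.toPerm _).symm.trans ((congrArg (Subgroup.map X.toPerm) X.closure_range_gen).trans
    (Subgroup.map_top_of_surjective _ X.isBraidedEpi_toPerm.2))

theorem lact_toPerm_permGen (a : X.symGroup.carrier) (x : X.carrier) :
    X.permGroup.lact (X.toPerm a) (X.permGen x) = X.permGen (X.Lhom a x) :=
  (X.isBraidedEpi_toPerm.1.map_lact a (X.gen x)).symm.trans (congrArg X.toPerm (X.la_gen_eq a x))

theorem permGen_eq_iff (x y : X.carrier) : X.permGen x = X.permGen y ↔ X.toRet x = X.toRet y :=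
  (Subtype.ext_iff.trans X.retSetoid_iff.symm).trans Quotient.eq.symm

/-- Both sides say that `𝓛ₐ` maps each `x` into its own retraction class: on the left as a
permutation of `Ret X`, on the right because `𝓛ₓ = 𝓛_y` means `[x] = [y]`. -/
theorem toPerm_mem_ker_phi_iff (a : X.symGroup.carrier) :
    X.toPerm a ∈ X.phi.ker ↔
      ∀ x, X.permGroup.lact (X.toPerm a) (X.permGen x) = X.permGen x := by
  simp only [lact_toPerm_permGen, permGen_eq_iff]
  rw [MonoidHom.mem_ker, phi_toPerm]
  refine Subtype.ext_iff.trans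
    ⟨fun h x => (X.Lhom_nu a x).symm.trans (Equiv.congr_fun h (X.toRet x)), fun h => ?_⟩
  ext x
  induction x using Quotient.inductionOn
  rename_i x
  exact (X.Lhom_nu a x).trans (h x)

/-- The kernel consists of the elements fixing every generator `𝓛ₓ`; being normal, it then fixes the
whole group. -/
theorem ker_phi : X.phi.ker = X.permGroup.soc := by
  refine le_antisymm
    (X.permGroup.le_soc_of_closure X.closure_range_permGen ?_) fun b hb => ?_
  · rintro b hb _ ⟨x, rfl⟩
    obtain ⟨a, rfl⟩ := X.isBraidedEpi_toPerm.2 b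
    exact (X.toPerm_mem_ker_phi_iff a).mp hb x
  · obtain ⟨a, rfl⟩ := X.isBraidedEpi_toPerm.2 b
    exact (X.toPerm_mem_ker_phi_iff a).mpr fun x => hb _

/-! ### Comparison of the two towers -/

theorem isBraidedEpi_toDerG (j : ℕ) : IsBraidedEpi (X.toDerG j) := by
  induction j with
  | zero => exact ⟨fun _ => rfl, Function.surjective_id⟩
  | succ j ih => exact (X.retIter j).isBraidedEpi_nu.comp ih

theorem isBraidedEpi_LJ_comp_toDerG (j : ℕ) :
    IsBraidedEpi (S := X.symGroup) (T := X.derP j) ((X.LJ j).comp (X.toDerG j)) :=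
  (X.retIter j).isBraidedEpi_toPerm.comp (X.isBraidedEpi_toDerG j)

theorem kerPullback_eq_ker (j : ℕ) : X.kerPullback j = ((X.LJ j).comp (X.toDerG j)).ker :=
  MonoidHom.comap_ker _ _

/-- By the commuting square the map `G → 𝓖_{j+1}` factors as `G → 𝓖_j` followed by `φ_j`, whose
kernel is the socle of `𝓖_j`. -/
theorem kerPullback_succ (j : ℕ) :
    X.kerPullback (j + 1) = (X.derP j).soc.comap ((X.LJ j).comp (X.toDerG j)) := by
  have h : (X.LJ (j + 1)).comp (X.toDerG (j + 1)) =
      (X.phiJ j).comp ((X.LJ j).comp (X.toDerG j)) :=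
    congrArg (fun g => g.comp (X.toDerG j)) (X.retIter j).phi_comp_toPerm.symm
  rw [kerPullback_eq_ker, h, ← MonoidHom.comap_ker]
  exact congrArg (Subgroup.comap _) (X.retIter j).ker_phi

/-- Both chains start with the socle of `G` and grow by pulling back the socle of the current
quotient. -/
theorem derivedChain_succ (j : ℕ) : X.symGroup.derivedChain (j + 1) = X.kerPullback j := by
  induction j with
  | zero => exact X.ker_toPerm.symm
  | succ j ih =>
    rw [kerPullback_succ]
    rw [SymGroup.derivedChain_eq_ker, kerPullback_eq_ker] at ih
    exact (X.symGroup.isBraidedEpi_toRetIter (j + 1)).comap_soc_congr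
      (X.isBraidedEpi_LJ_comp_toDerG j) ih

theorem retIter_symGroup_isomorphic (j : ℕ) :
    (X.symGroup.retIter (j + 1)).Isomorphic (X.retIter j).permGroup := by
  refine (X.symGroup.isBraidedEpi_toRetIter (j + 1)).isomorphic
    (X.isBraidedEpi_LJ_comp_toDerG j) ?_
  rw [← SymGroup.derivedChain_eq_ker, derivedChain_succ]
  exact X.kerPullback_eq_ker j

/-! ### Multipermutation levels -/

theorem bot_ne_top_symGroup : (⊥ : Subgroup X.symGroup.carrier) ≠ ⊤ :=
  have := X.infinite_symGroup
  bot_ne_top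

theorem derivedChain_zero_lt_one
    (h : Finite X.carrier ∨ ∃ m, X.symGroup.toYB.MplEq m) :
    X.symGroup.derivedChain 0 < X.symGroup.derivedChain 1 := by
  refine bot_lt_iff_ne_bot.mpr fun hbot => ?_
  rcases h with h | ⟨m, hm⟩
  -- A trivial socle would embed the infinite group `G` in the finite group `Sym X`.
  · have hker : X.toPerm.ker = ⊥ := X.ker_toPerm.trans hbot
    have hinj : Function.Injective X.toPerm := (MonoidHom.ker_eq_bot_iff _).mp hker
    have := X.infinite_symGroup
    have hfin : Finite X.permGroup.carrier := inferInstanceAs (Finite X.Lhom.range)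
    exact not_finite_iff_infinite.mpr this (Finite.of_injective _ hinj)
  · have htop : X.symGroup.derivedChain m = ⊤ := ((X.symGroup.mplEq_iff m).mp hm).1
    exact X.bot_ne_top_symGroup ((X.symGroup.derivedChain_eq_bot hbot m).symm.trans htop)

theorem mplEq_permGroup_iff (m : ℕ) :
    X.permGroup.toYB.MplEq m ↔ X.symGroup.toYB.MplEq (m + 1) := by
  have hk := SymGroup.derivedChain_eq_top_iff X.isBraidedEpi_toPerm X.ker_toPerm
  rw [SymGroup.mplEq_iff, SymGroup.mplEq_iff]
  constructor
  · rintro ⟨h, hmin⟩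
    refine ⟨(hk m).mp h, fun k hkt => ?_⟩
    cases k with
    -- Level `0` of `G` has no counterpart in the chain of `𝓖`; it is excluded because `G` is
    -- nontrivial.
    | zero => exact (X.bot_ne_top_symGroup hkt).elim
    | succ k => exact Nat.succ_le_succ (hmin ((hk k).mpr hkt))
  · rintro ⟨h, hmin⟩
    exact ⟨(hk m).mpr h, fun k hkt => Nat.le_of_succ_le_succ (hmin ((hk k).mp hkt))⟩

end YBSolution

theorem mainTheorem5 (X : YBSolution.{u}) :
    -- the retractions of the symmetric group `G = G(X, r)`
    (∀ j : ℕ, (X.symGroup.retIter (j + 1)).Isomorphic (X.retIter j).permGroup) ∧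
    -- the maps of the diagram are epimorphisms of symmetric groups given on generators as usual
    (∀ j : ℕ,
      (IsBraidedEpi (X.nuJ j) ∧ ∀ x, X.nuJ j (X.genG x j) = X.genG x (j + 1)) ∧
      (IsBraidedEpi (X.LJ j) ∧ ∀ x, X.LJ j (X.genG x j) = X.genP x j) ∧
      (IsBraidedEpi (X.fJ j) ∧ ∀ x, X.fJ j (X.genG x (j + 1)) = X.genP x j) ∧
      (IsBraidedEpi (X.phiJ j) ∧ ∀ x, X.phiJ j (X.genP x j) = X.genP x (j + 1))) ∧
    -- the diagram commutes
    (∀ j : ℕ,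
      (X.fJ j).comp (X.nuJ j) = X.LJ j ∧
      (X.phiJ j).comp (X.fJ j) = X.LJ (j + 1) ∧
      (X.phiJ j).comp (X.LJ j) = (X.LJ (j + 1)).comp (X.nuJ j)) ∧
    -- the derived chain of ideals of `G`
    (∀ j : ℕ, X.symGroup.IsIdeal (X.symGroup.derivedChain j)) ∧
    X.symGroup.derivedChain 0 = ⊥ ∧
    (∀ j : ℕ, X.symGroup.derivedChain (j + 1) = X.kerPullback j) ∧
    Monotone X.symGroup.derivedChain ∧
    (Finite X.carrier ∨ (∃ m, X.symGroup.toYB.MplEq m) →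
      X.symGroup.derivedChain 0 < X.symGroup.derivedChain 1) ∧
    -- the multipermutation levels, for `m ≥ 1` and for `m = 0` (with `𝓚_{-1} = {1}`)
    (∀ m : ℕ, 1 ≤ m →
      ((X.symGroup.toYB.MplEq (m + 1) ↔
        X.kerPullback (m - 1) < X.kerPullback m ∧ X.kerPullback m = ⊤) ∧
      ((X.kerPullback (m - 1) < X.kerPullback m ∧ X.kerPullback m = ⊤) ↔
        X.permGroup.toYB.MplEq m))) ∧
    ((X.symGroup.toYB.MplEq 1 ↔ ⊥ < X.kerPullback 0 ∧ X.kerPullback 0 = ⊤) ∧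
      ((⊥ < X.kerPullback 0 ∧ X.kerPullback 0 = ⊤) ↔ X.permGroup.toYB.MplEq 0)) := by
  refine ⟨X.retIter_symGroup_isomorphic, fun j => ⟨⟨(X.retIter j).isBraidedEpi_nu, fun x =>
      (X.retIter j).nu_gen _⟩, ⟨(X.retIter j).isBraidedEpi_toPerm, fun x => rfl⟩,
      ⟨(X.retIter j).isBraidedEpi_retToPerm, fun x => (X.retIter j).retToPerm_gen _⟩,
      ⟨(X.retIter j).isBraidedEpi_phi, fun x => (X.retIter j).phi_permGen _⟩⟩,
    fun j => ⟨(X.retIter j).retToPerm_comp_nu, (X.retIter j).phi_comp_retToPerm,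
      (X.retIter j).phi_comp_toPerm⟩,
    X.symGroup.isIdeal_derivedChain, rfl, X.derivedChain_succ,
    X.symGroup.monotone_derivedChain, X.derivedChain_zero_lt_one, fun m hm => ?_, ?_⟩
  -- For `m = k + 1` both `K_m` and `K_{m+1}` have positive index, so both can be rewritten as
  -- `𝓚`'s; for `m = 0` the lower term is `K_0`, which is `⊥` by definition.
  · obtain ⟨k, rfl⟩ := Nat.exists_eq_add_of_le' hm
    have h := X.symGroup.mplEq_succ_iff (k + 1)
    rw [X.derivedChain_succ, X.derivedChain_succ] at h
    exact ⟨h, h.symm.trans (X.mplEq_permGroup_iff _).symm⟩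
  · have h := X.symGroup.mplEq_succ_iff 0
    rw [X.derivedChain_succ] at h
    exact ⟨h, h.symm.trans (X.mplEq_permGroup_iff 0).symm⟩
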